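/- Let $\Gamma$ be a finitely generated abelian group, $g_1,\dots,g_r$ a finite family of generators of $\Gamma$, and $n\ge 1$ an integer. Let $X_0$ be the metric graph with vertex set $\Gamma$ that has, for every $\gamma\in\Gamma$ and every $1\le j\le r$, one edge from $\gamma$ to $g_j+\gamma$ (the Cayley graph of $\Gamma$) and, in addition, $n$ loops attached at every vertex $\gamma$; all edges and loops have length $1$. Let $\Delta_{X_0}$ be the Kirchhoff Laplacian of $X_0$, i.e. the non-negative self-adjoint operator in $L^2(X_0)=\bigoplus_e L^2([0,1])$ associated with the closed quadratic form $u\mapsto \|u'\|^2=\sum_e\int_0^1|u_e'(x)|^2\,dx$ on $H^1(X_0)$, the space of all $u\in L^2(X_0)$ that are continuous on $X_0$, absolutely continuous on each edge, and satisfy $u'\in L^2(X_0)$. (Thus $\Delta_{X_0}u=-u''$ on each edge, with continuity at each vertex and vanishing sum of the outgoing derivatives there.) Then $\Delta_{X_0}$ has infinitely many spectral gaps: there are infinitely many pairs $a<b$ of points of $\operatorname{spec}\Delta_{X_0}$ such that $(a,b)\cap\operatorname{spec}\Delta_{X_0}=\emptyset$. -/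

import Mathlib

open MeasureTheory Set
open scoped ContDiff InnerProductSpace ENNReal

noncomputable section

/-- A metric multigraph all of whose edges have length one: the edge `e` is a copy of the interval
`[0, 1]`, whose point `0` is glued to the vertex `src e` and whose point `1` to `tgt e`.
Loops (`src e = tgt e`) and multiple edges are allowed. The orientation only fixes the
parametrization of the edges. -/
structure UnitMetricGraph (V E : Type*) where
  src : E → V
  tgt : E → V

/-- The Cayley graph of the abelian group `Γ` with respect to a family `g` of generators (for every
`γ` and every generator `g i` there is one edge from `γ` to `g i + γ`, so every vertex has degree
`2 r` for `r` generators), with `n` loops attached at each vertex. -/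
def cayleyGraphWithLoops {Γ ι : Type*} [AddCommGroup Γ] (g : ι → Γ) (n : ℕ) :
    UnitMetricGraph Γ (Γ × (ι ⊕ Fin n)) where
  src e := e.1
  tgt e := Sum.elim (fun i => g i + e.1) (fun _ => e.1) e.2

/-- The complex Hilbert space `L²([0, 1])`. -/
abbrev EdgeL2 : Type := Lp ℂ 2 ((volume : Measure ℝ).restrict (Icc 0 1))

/-- The Hilbert space `L²(X)` of a metric graph `X` with edge set `E` and unit edge lengths: the
Hilbert direct sum over all edges of `L²([0, 1])`. -/
abbrev GraphL2 (E : Type*) : Type _ := lp (fun _ : E => EdgeL2) 2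

theorem EdgeL2.integrableOn (w : EdgeL2) : IntegrableOn w (Icc 0 1) volume :=
  (Lp.memLp w).integrable (by norm_num)

theorem EdgeL2.intervalIntegrable (w : EdgeL2) {x : ℝ} (hx : x ∈ Icc (0 : ℝ) 1) :
    IntervalIntegrable w volume 0 x := by
  rw [intervalIntegrable_iff_integrableOn_Icc_of_le hx.1]
  exact (EdgeL2.integrableOn w).mono_set (Icc_subset_Icc_right hx.2)

theorem EdgeL2.integral_add (v w : EdgeL2) {x : ℝ} (hx : x ∈ Icc (0 : ℝ) 1) :
    ∫ t in (0 : ℝ)..x, (v + w : EdgeL2) t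
      = (∫ t in (0 : ℝ)..x, v t) + ∫ t in (0 : ℝ)..x, w t := by
  rw [← intervalIntegral.integral_add (v.intervalIntegrable hx) (w.intervalIntegrable hx)]
  apply intervalIntegral.integral_congr_ae
  have h := (ae_restrict_iff' measurableSet_Icc).1 (Lp.coeFn_add v w)
  filter_upwards [h] with t ht hmem
  rw [uIoc_of_le hx.1] at hmem
  exact ht ⟨hmem.1.le, hmem.2.trans hx.2⟩

theorem EdgeL2.integral_smul (c : ℂ) (w : EdgeL2) {x : ℝ} (hx : x ∈ Icc (0 : ℝ) 1) :
    ∫ t in (0 : ℝ)..x, (c • w : EdgeL2) t = c * ∫ t in (0 : ℝ)..x, w t := by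
  rw [← intervalIntegral.integral_const_mul]
  apply intervalIntegral.integral_congr_ae
  have h := (ae_restrict_iff' measurableSet_Icc).1 (Lp.coeFn_smul c w)
  filter_upwards [h] with t ht hmem
  rw [uIoc_of_le hx.1] at hmem
  exact ht ⟨hmem.1.le, hmem.2.trans hx.2⟩

theorem EdgeL2.integral_zero {x : ℝ} (hx : x ∈ Icc (0 : ℝ) 1) :
    ∫ t in (0 : ℝ)..x, (0 : EdgeL2) t = 0 := by
  simpa using EdgeL2.integral_smul 0 0 hx

theorem EdgeL2.eq_zero_of_ae (w : EdgeL2) (h : ∀ᵐ x, x ∈ Ioo (0 : ℝ) 1 → w x = 0) : w = 0 := by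
  refine Lp.ext (Filter.EventuallyEq.trans ?_ (Lp.coeFn_zero ℂ 2 _).symm)
  have h' := (ae_restrict_iff' (μ := (volume : Measure ℝ)) measurableSet_Ioo).2 h
  rw [restrict_Ioo_eq_restrict_Icc] at h'
  exact h'

namespace UnitMetricGraph

variable {V E : Type*} (X : UnitMetricGraph V E)

/-- `X.HasH1Deriv u w` says that `u ∈ L²(X)` belongs to the Sobolev space `H¹(X)` and that
`w ∈ L²(X)` is its derivative along the edges: on every edge `u` is (almost everywhere equal to) an
absolutely continuous function with the square integrable derivative `w`, and these functions fit
together to a continuous function on `X`, whose value at the vertex `v` is `φ v`. -/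
def HasH1Deriv (u w : GraphL2 E) : Prop :=
  ∃ φ : V → ℂ, ∀ e : E,
    (∀ᵐ x ∂((volume : Measure ℝ).restrict (Icc 0 1)),
      u e x = φ (X.src e) + ∫ t in (0 : ℝ)..x, w e t) ∧
    φ (X.tgt e) = φ (X.src e) + ∫ t in (0 : ℝ)..1, w e t

theorem HasH1Deriv.add {u w u' w' : GraphL2 E} (h : X.HasH1Deriv u w) (h' : X.HasH1Deriv u' w') :
    X.HasH1Deriv (u + u') (w + w') := by
  obtain ⟨φ, hφ⟩ := h
  obtain ⟨φ', hφ'⟩ := h'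
  refine ⟨φ + φ', fun e => ⟨?_, ?_⟩⟩
  · filter_upwards [(hφ e).1, (hφ' e).1, Lp.coeFn_add (u e) (u' e),
      ae_restrict_mem measurableSet_Icc] with x h1 h2 h3 hx
    rw [lp.coeFn_add, lp.coeFn_add, Pi.add_apply, Pi.add_apply, Pi.add_apply, h3, Pi.add_apply,
      h1, h2, EdgeL2.integral_add _ _ hx]
    ring
  · rw [lp.coeFn_add, Pi.add_apply, Pi.add_apply, Pi.add_apply, (hφ e).2, (hφ' e).2,
      EdgeL2.integral_add _ _ (by simp)]
    ring

theorem HasH1Deriv.smul (c : ℂ) {u w : GraphL2 E} (h : X.HasH1Deriv u w) :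
    X.HasH1Deriv (c • u) (c • w) := by
  obtain ⟨φ, hφ⟩ := h
  refine ⟨c • φ, fun e => ⟨?_, ?_⟩⟩
  · filter_upwards [(hφ e).1, Lp.coeFn_smul c (u e),
      ae_restrict_mem measurableSet_Icc] with x h1 h3 hx
    rw [lp.coeFn_smul, lp.coeFn_smul, Pi.smul_apply, Pi.smul_apply, Pi.smul_apply, h3,
      Pi.smul_apply, h1, EdgeL2.integral_smul _ _ hx, smul_eq_mul, smul_eq_mul]
    ring
  · rw [lp.coeFn_smul, Pi.smul_apply, Pi.smul_apply, Pi.smul_apply, (hφ e).2,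
      EdgeL2.integral_smul _ _ (by simp), smul_eq_mul, smul_eq_mul]
    ring

theorem hasH1Deriv_zero : X.HasH1Deriv 0 0 := by
  refine ⟨0, fun e => ⟨?_, ?_⟩⟩
  · filter_upwards [Lp.coeFn_zero ℂ 2 ((volume : Measure ℝ).restrict (Icc 0 1)),
      ae_restrict_mem measurableSet_Icc] with x h1 hx
    rw [lp.coeFn_zero, Pi.zero_apply, h1, EdgeL2.integral_zero hx]
    simp
  · rw [lp.coeFn_zero, Pi.zero_apply, Pi.zero_apply, Pi.zero_apply,
      EdgeL2.integral_zero (by simp)]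
    simp

/-- The graph of the Laplacian: the pairs `(u, f)` such that `u ∈ H¹(X)` and
`⟨v', u'⟩ = ⟨v, f⟩` for all `v ∈ H¹(X)`. -/
def laplacianGraph : Submodule ℂ (GraphL2 E × GraphL2 E) where
  carrier := {p | ∃ w, X.HasH1Deriv p.1 w ∧
    ∀ v v', X.HasH1Deriv v v' → ⟪v', w⟫_ℂ = ⟪v, p.2⟫_ℂ}
  zero_mem' := ⟨0, X.hasH1Deriv_zero, fun v v' _ => by simp⟩
  add_mem' := by
    rintro p q ⟨w, h1, h2⟩ ⟨w', h1', h2'⟩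
    refine ⟨w + w', h1.add X h1', fun v v' hv => ?_⟩
    rw [Prod.snd_add, inner_add_right, inner_add_right, h2 v v' hv, h2' v v' hv]
  smul_mem' := by
    rintro c p ⟨w, h1, h2⟩
    refine ⟨c • w, h1.smul X c, fun v v' hv => ?_⟩
    rw [Prod.smul_snd, inner_smul_right, inner_smul_right, h2 v v' hv]

/-- The (Kirchhoff) Laplacian of the metric graph `X`: the self-adjoint operator in `L²(X)` that is
associated with the closed quadratic form `u ↦ ‖u'‖²` with form domain `H¹(X)`. It acts as
`u ↦ -u''` on every edge, on functions that are continuous at the vertices and satisfy the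
Kirchhoff condition there (the derivatives in the directions away from the vertex add up to `0`).
That the relation `laplacianGraph` is the graph of an operator is shown in `laplacian_graph`. -/
def laplacian : GraphL2 E →ₗ.[ℂ] GraphL2 E :=
  X.laplacianGraph.toLinearPMap

theorem HasH1Deriv.eq_zero {w : GraphL2 E} (h : X.HasH1Deriv 0 w) : w = 0 := by
  obtain ⟨φ, hφ⟩ := h
  ext1
  funext e
  have hw := EdgeL2.intervalIntegrable (w e) (x := 1) (by simp)
  have hint := EdgeL2.integrableOn (w e)
  have hcont : ContinuousOn (fun x => φ (X.src e) + ∫ t in (0 : ℝ)..x, w e t) (Icc 0 1) := by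
    refine continuousOn_const.add ?_
    have := intervalIntegral.continuousOn_primitive_interval (a := (0 : ℝ)) (b := 1)
      (μ := volume) (f := w e) (by rwa [uIcc_of_le zero_le_one])
    rwa [uIcc_of_le zero_le_one] at this
  have hz : ∀ᵐ x ∂((volume : Measure ℝ).restrict (Ioo 0 1)),
      φ (X.src e) + ∫ t in (0 : ℝ)..x, w e t = 0 := by
    have h1 := (hφ e).1
    refine ae_mono (Measure.restrict_mono Ioo_subset_Icc_self le_rfl) ?_
    filter_upwards [h1, Lp.coeFn_zero ℂ 2 ((volume : Measure ℝ).restrict (Icc 0 1))] with x h2 h3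
    rw [← h2, lp.coeFn_zero, Pi.zero_apply, h3, Pi.zero_apply]
  have hz' : EqOn (fun x => φ (X.src e) + ∫ t in (0 : ℝ)..x, w e t) (fun _ => 0) (Ioo 0 1) :=
    Measure.eqOn_open_of_ae_eq hz isOpen_Ioo (hcont.mono Ioo_subset_Icc_self) continuousOn_const
  rw [lp.coeFn_zero, Pi.zero_apply]
  refine EdgeL2.eq_zero_of_ae _ ?_
  filter_upwards [hw.ae_hasDerivAt_integral] with x hx hmem
  rw [uIcc_of_le zero_le_one] at hx
  have hd := (hx (Ioo_subset_Icc_self hmem) 0 (by simp)).const_add (φ (X.src e))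
  have hd' : HasDerivAt (fun x => φ (X.src e) + ∫ t in (0 : ℝ)..x, w e t) 0 x :=
    (hasDerivAt_const x (0 : ℂ)).congr_of_eventuallyEq
      (hz'.eventuallyEq_of_mem (isOpen_Ioo.mem_nhds hmem))
  exact hd.unique hd'

theorem laplacianGraph_singleValued (p : GraphL2 E × GraphL2 E) (hp : p ∈ X.laplacianGraph)
    (hp1 : p.1 = 0) : p.2 = 0 := by
  classical
  obtain ⟨u, f⟩ := p
  obtain ⟨w, hw, horth⟩ := hp
  simp only at hp1 hw horth ⊢
  subst hp1
  obtain rfl : w = 0 := hw.eq_zero X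
  ext1
  funext e
  rw [lp.coeFn_zero, Pi.zero_apply]
  refine EdgeL2.eq_zero_of_ae _ ?_
  refine isOpen_Ioo.ae_eq_zero_of_integral_contDiff_smul_eq_zero
    ((EdgeL2.integrableOn (f e)).mono_set Ioo_subset_Icc_self).locallyIntegrableOn ?_
  intro g hg hgc hgs
  have hmem : ∀ k : ℝ → ℂ, Continuous k →
      MemLp k 2 ((volume : Measure ℝ).restrict (Icc 0 1)) := by
    intro k hk
    obtain ⟨C, hC⟩ := isCompact_Icc.exists_bound_of_continuousOn (hk.continuousOn (s := Icc 0 1))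
    exact MemLp.of_bound hk.aestronglyMeasurable C
      ((ae_restrict_mem measurableSet_Icc).mono hC)
  have hgC : ContDiff ℝ ∞ (fun x => (g x : ℂ)) := Complex.ofRealCLM.contDiff.comp hg
  have hder : ∀ x, HasDerivAt (fun x => (g x : ℂ)) ((deriv g x : ℝ) : ℂ) x := fun x =>
    ((hg.differentiable (by simp) x).hasDerivAt).ofReal_comp
  have hdcont : Continuous (fun x => ((deriv g x : ℝ) : ℂ)) :=
    Complex.continuous_ofReal.comp (hg.continuous_deriv (by simp))
  have hg0 : g 0 = 0 := image_eq_zero_of_notMem_tsupport fun h => by simpa using (hgs h).1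
  have hg1 : g 1 = 0 := image_eq_zero_of_notMem_tsupport fun h => by simpa using (hgs h).2
  have hFTC : ∀ x ∈ Icc (0 : ℝ) 1, ∫ t in (0 : ℝ)..x, ((hmem _ hdcont).toLp _ : EdgeL2) t
      = g x := by
    intro x hx
    have : ∫ t in (0 : ℝ)..x, ((hmem _ hdcont).toLp _ : EdgeL2) t
        = ∫ t in (0 : ℝ)..x, ((deriv g t : ℝ) : ℂ) := by
      apply intervalIntegral.integral_congr_ae
      filter_upwards [(ae_restrict_iff' measurableSet_Icc).1 (hmem _ hdcont).coeFn_toLp]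
        with t ht hmem
      rw [uIoc_of_le hx.1] at hmem
      exact ht ⟨hmem.1.le, hmem.2.trans hx.2⟩
    rw [this, intervalIntegral.integral_eq_sub_of_hasDerivAt (fun t _ => hder t)
      (hdcont.intervalIntegrable _ _), hg0]
    simp
  have hH1 : X.HasH1Deriv (lp.single 2 e ((hmem _ hgC.continuous).toLp _ : EdgeL2))
      (lp.single 2 e ((hmem _ hdcont).toLp _ : EdgeL2)) := by
    refine ⟨0, fun e' => ?_⟩
    by_cases he : e' = e
    · subst he
      simp only [lp.single_apply_self]
      refine ⟨?_, ?_⟩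
      · filter_upwards [(hmem _ hgC.continuous).coeFn_toLp, ae_restrict_mem measurableSet_Icc]
          with x h1 hx
        rw [hFTC x hx, h1]
        simp
      · rw [hFTC 1 (by simp), hg1]
        simp
    · rw [lp.single_apply_ne _ _ _ he, lp.single_apply_ne _ _ _ he]
      refine ⟨?_, ?_⟩
      · filter_upwards [Lp.coeFn_zero ℂ 2 ((volume : Measure ℝ).restrict (Icc 0 1)),
          ae_restrict_mem measurableSet_Icc] with x h1 hx
        rw [h1, EdgeL2.integral_zero hx]
        simp
      · rw [EdgeL2.integral_zero (by simp)]
        simp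
  have key := horth _ _ hH1
  rw [inner_zero_right, lp.inner_single_left, L2.inner_def] at key
  have hrestr : ∫ x in Icc (0 : ℝ) 1, g x • f e x = ∫ x, g x • f e x := by
    refine setIntegral_eq_integral_of_forall_compl_eq_zero fun x hx => ?_
    have : g x = 0 :=
      image_eq_zero_of_notMem_tsupport fun h => hx (Ioo_subset_Icc_self (hgs h))
    rw [this, zero_smul]
  rw [← hrestr, key]
  refine integral_congr_ae ?_
  filter_upwards [(hmem _ hgC.continuous).coeFn_toLp] with x h1
  rw [h1]
  simp [mul_comm]

theorem laplacian_graph : X.laplacian.graph = X.laplacianGraph :=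
  Submodule.toLinearPMap_graph_eq _ X.laplacianGraph_singleValued

end UnitMetricGraph

/-- The spectrum of an unbounded operator `T`: the complement of the set of all `z` for which
`T - z` has a bounded everywhere defined inverse `R`. -/
def unboundedSpectrum {H : Type*} [NormedAddCommGroup H] [NormedSpace ℂ H] (T : H →ₗ.[ℂ] H) :
    Set ℂ :=
  {z | ¬ ∃ R : H →L[ℂ] H, (∀ u : T.domain, R (T u - z • (u : H)) = u) ∧
    ∀ f : H, ∃ h : R f ∈ T.domain, T ⟨R f, h⟩ - z • R f = f}

/-- The spectral gaps of `T` (for `T` with real spectrum): the pairs `(a, b)` such that the open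
interval from `a` to `b` contains no point of the spectrum and is maximal with this property,
that is, both of its ends belong to the spectrum. -/
def spectralGaps {H : Type*} [NormedAddCommGroup H] [NormedSpace ℂ H] (T : H →ₗ.[ℂ] H) :
    Set (ℝ × ℝ) :=
  {p | p.1 < p.2 ∧ (p.1 : ℂ) ∈ unboundedSpectrum T ∧ (p.2 : ℂ) ∈ unboundedSpectrum T ∧
    ∀ x ∈ Ioo p.1 p.2, (x : ℂ) ∉ unboundedSpectrum T}

end

/-! The spectrum is closed, so infinitely many gaps appear once infinitely many spectral points are
separated by points outside the spectrum.

Spectral points come from the loops: `sin (2πmx)` on one loop, extended by zero, vanishes at the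
vertex and has equal derivatives at both ends of the loop, so its two outgoing derivatives cancel.
Hence `(2πm)²` is an eigenvalue for every `m ≥ 1` (`UnitMetricGraph.mem_spectrum_of_loop`).

Separating points come from solving `-u'' - k²u = f`. When `sin k ≠ 0`, the edge equation is
solvable for arbitrary vertex values `φ` (`EdgeL2.exists_solution`), and the Kirchhoff condition
becomes a difference equation on `Γ`, `D φ(γ) + ∑ i, (φ(γ - g i) + φ(γ + g i)) = h(γ)`, with `D = 2n
- 2(n + r) cos k`. If `(n + r) cos k < n - r`, then `D > 2r`, the equation is diagonally dominant,
and a Neumann series solves it in `ℓ²` (`exists_solution_differenceEquation`). Thus the Laplacian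
minus `k²` is onto; for a symmetric operator this puts `k²` outside the spectrum
(`notMem_unboundedSpectrum_of_surjective`).

Since `n ≥ 1` gives `(n - r)/(n + r) > -1`, some `θ` in `(0, π)` satisfies the inequality, and so
does every `θ + 2πm`. The square of such a point lies between consecutive loop eigenvalues, which
yields a gap there. -/

/-! ### Absolutely continuous functions on the unit interval -/

/-- `F` is absolutely continuous on `[0, 1]` with integrable derivative `f`. -/
structure IsPrimitive (F f : ℝ → ℂ) : Prop where
  ac : AbsolutelyContinuousOnInterval F 0 1
  int : IntervalIntegrable f volume 0 1
  deriv : ∀ᵐ x, x ∈ uIcc (0 : ℝ) 1 → HasDerivAt F (f x) x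

theorem IntervalIntegrable.absolutelyContinuousOnInterval_integral_complex {f : ℝ → ℂ}
    (h : IntervalIntegrable f volume 0 1) :
    AbsolutelyContinuousOnInterval (fun x => ∫ t in (0 : ℝ)..x, f t) 0 1 := by
  have hre : IntervalIntegrable (fun x => (f x).re) volume 0 1 := ⟨h.1.re, h.2.re⟩
  have him : IntervalIntegrable (fun x => (f x).im) volume 0 1 := ⟨h.1.im, h.2.im⟩
  have hconst : ∀ c : ℂ, AbsolutelyContinuousOnInterval (fun _ => c) 0 1 := fun c =>
    contDiff_const.contDiffOn.absolutelyContinuousOnInterval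
  have H := ((hre.absolutelyContinuousOnInterval_intervalIntegral (c := 0) (by simp)).smul
    (hconst 1)).add
    ((him.absolutelyContinuousOnInterval_intervalIntegral (c := 0) (by simp)).smul
    (hconst Complex.I))
  unfold AbsolutelyContinuousOnInterval at H ⊢
  -- The decomposition into real and imaginary integrals is only available on `[0, 1]`, so the
  -- functions are compared only on families of intervals inside it.
  refine H.congr' ?_
  rw [Filter.EventuallyEq, Filter.eventually_inf_principal]
  filter_upwards with p hp
  refine Finset.sum_congr rfl fun i hi => ?_
  have key : ∀ x ∈ uIcc (0 : ℝ) 1, ∫ t in (0 : ℝ)..x, f t =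
      (∫ t in (0 : ℝ)..x, (f t).re) • (1 : ℂ) + (∫ t in (0 : ℝ)..x, (f t).im) • Complex.I := by
    intro x hx
    have hx' : IntervalIntegrable f volume 0 x := h.mono_set (uIcc_subset_uIcc_left hx)
    have h1 := intervalIntegral.intervalIntegral_re hx'
    have h2 := intervalIntegral.intervalIntegral_im hx'
    simp only [RCLike.re_to_complex, RCLike.im_to_complex] at h1 h2
    rw [h1, h2]
    apply Complex.ext <;> simp
  have hm := hp.1 i (Finset.mem_range.2 (by simpa using hi))
  rw [key _ hm.1, key _ hm.2]
  rfl

namespace IsPrimitive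

variable {F f G g : ℝ → ℂ}

theorem of_integral (h : IntervalIntegrable f volume 0 1) :
    IsPrimitive (fun x => ∫ t in (0 : ℝ)..x, f t) f :=
  ⟨h.absolutelyContinuousOnInterval_integral_complex, h, by
    filter_upwards [h.ae_hasDerivAt_integral] with x hx hm using hx hm 0 (by simp)⟩

theorem of_contDiff (hF : ContDiff ℝ 1 F) (hf : ∀ x, HasDerivAt F (f x) x) : IsPrimitive F f := by
  refine ⟨hF.contDiffOn.absolutelyContinuousOnInterval, ?_, by filter_upwards with x _ using hf x⟩
  have : f = _root_.deriv F := funext fun x => (hf x).deriv.symm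
  rw [this]
  exact (hF.continuous_deriv le_rfl).intervalIntegrable _ _

theorem add (hF : IsPrimitive F f) (hG : IsPrimitive G g) :
    IsPrimitive (fun x => F x + G x) (fun x => f x + g x) :=
  ⟨hF.ac.add hG.ac, hF.int.add hG.int, by
    filter_upwards [hF.deriv, hG.deriv] with x h1 h2 hx using (h1 hx).add (h2 hx)⟩

theorem mul (hF : IsPrimitive F f) (hG : IsPrimitive G g) :
    IsPrimitive (fun x => F x * G x) (fun x => f x * G x + F x * g x) :=
  ⟨hF.ac.smul hG.ac,
    (hF.int.mul_continuousOn hG.ac.continuousOn).add (hG.int.continuousOn_mul hF.ac.continuousOn),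
    by filter_upwards [hF.deriv, hG.deriv] with x h1 h2 hx using (h1 hx).mul (h2 hx)⟩

theorem const (c : ℂ) : IsPrimitive (fun _ => c) (fun _ => 0) :=
  of_contDiff contDiff_const fun x => hasDerivAt_const x c

theorem const_mul (c : ℂ) (hF : IsPrimitive F f) :
    IsPrimitive (fun x => c * F x) (fun x => c * f x) := by
  simpa using (const c).mul hF

theorem congr (hF : IsPrimitive F f) (h : ∀ x, G x = F x) : IsPrimitive G f :=
  (funext h : G = F) ▸ hF

theorem congr_deriv (hF : IsPrimitive F f) (h : ∀ᵐ x, x ∈ uIcc (0 : ℝ) 1 → f x = g x) :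
    IsPrimitive F g := by
  refine ⟨hF.ac, hF.int.congr_ae ?_, ?_⟩
  · rw [Filter.EventuallyEq, ae_restrict_iff' measurableSet_uIoc]
    filter_upwards [h] with x hx hm using hx (uIoc_subset_uIcc hm)
  · filter_upwards [h, hF.deriv] with x hx hd hm using hx hm ▸ hd hm

/-- `F` minus the integral of `f` is absolutely continuous with derivative zero almost everywhere,
hence constant. -/
theorem eq_add_integral (hF : IsPrimitive F f) {x : ℝ} (hx : x ∈ Icc (0 : ℝ) 1) :
    F x = F 0 + ∫ t in (0 : ℝ)..x, f t := by
  have hI := of_integral hF.int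
  obtain ⟨C, hC⟩ := (hF.ac.sub hI.ac).const_of_ae_hasDerivAt_zero (by
    filter_upwards [hF.deriv, hI.deriv] with x h1 h2 hx
    simpa using (h1 hx).sub (h2 hx))
  have h0 := hC 0 (by simp)
  have h1 := hC x (by rwa [uIcc_of_le zero_le_one])
  simp only [Pi.sub_apply, intervalIntegral.integral_same, sub_zero] at h0 h1
  rw [h0, ← h1]
  ring

theorem conj (hF : IsPrimitive F f) :
    IsPrimitive (fun x => (starRingEnd ℂ) (F x)) (fun x => (starRingEnd ℂ) (f x)) := by
  refine ⟨?_, ?_, ?_⟩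
  · have h := hF.ac
    unfold AbsolutelyContinuousOnInterval at h ⊢
    simpa [Complex.dist_conj_conj] using h
  · exact ⟨(Complex.conjLIE.toContinuousLinearEquiv.toContinuousLinearMap.integrable_comp
      hF.int.1), (Complex.conjLIE.toContinuousLinearEquiv.toContinuousLinearMap.integrable_comp
      hF.int.2)⟩
  · filter_upwards [hF.deriv] with x h hx
    exact (h hx).star

theorem memLp (hF : IsPrimitive F f) :
    MemLp F 2 ((volume : Measure ℝ).restrict (Icc 0 1)) := by
  have hc : ContinuousOn F (Icc 0 1) := by simpa [uIcc_of_le] using hF.ac.continuousOn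
  obtain ⟨C, hC⟩ := isCompact_Icc.exists_bound_of_continuousOn hc
  exact MemLp.of_bound (hc.aestronglyMeasurable measurableSet_Icc) C
    ((ae_restrict_mem measurableSet_Icc).mono hC)

/-- Integration by parts. -/
theorem integral_conj_mul (hF : IsPrimitive F f) (hG : IsPrimitive G g) :
    ∫ t in (0 : ℝ)..1, ((starRingEnd ℂ) (f t) * G t + (starRingEnd ℂ) (F t) * g t) =
      (starRingEnd ℂ) (F 1) * G 1 - (starRingEnd ℂ) (F 0) * G 0 := by
  have h := (hF.conj.mul hG).eq_add_integral (x := 1) (by simp)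
  rw [h]
  ring

end IsPrimitive

/-! ### Analysis on a single edge -/

instance isProbabilityMeasure_restrict_Icc_zero_one :
    IsProbabilityMeasure ((volume : Measure ℝ).restrict (Icc 0 1)) := ⟨by simp⟩

namespace EdgeL2

theorem integral_norm_le (f : EdgeL2) : ∫ t in Icc (0 : ℝ) 1, ‖f t‖ ≤ ‖f‖ := by
  have hm := Lp.memLp f
  have h := eLpNorm_le_eLpNorm_of_exponent_le (p := 1) (q := 2) (by norm_num)
    hm.aestronglyMeasurable
  rw [Lp.norm_def, integral_norm_eq_lintegral_enorm hm.aestronglyMeasurable,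
    ← eLpNorm_one_eq_lintegral_enorm]
  exact ENNReal.toReal_mono hm.eLpNorm_ne_top h

theorem norm_integral_mul_le (f : EdgeL2) {a : ℝ → ℂ} {x : ℝ} (hx : x ∈ Icc (0 : ℝ) 1)
    (ha : ∀ t, ‖a t‖ ≤ 1) : ‖∫ t in (0 : ℝ)..x, a t * f t‖ ≤ ‖f‖ := by
  refine le_trans ?_ f.integral_norm_le
  rw [integral_Icc_eq_integral_Ioc, ← intervalIntegral.integral_of_le zero_le_one]
  have hint : IntervalIntegrable (fun t => ‖f t‖) volume 0 1 :=
    (f.intervalIntegrable (by simp)).norm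
  calc ‖∫ t in (0 : ℝ)..x, a t * f t‖ ≤ ∫ t in (0 : ℝ)..x, ‖f t‖ := by
        refine intervalIntegral.norm_integral_le_of_norm_le hx.1 ?_
          (f.intervalIntegrable hx).norm
        filter_upwards with t _
        rw [norm_mul]
        exact mul_le_of_le_one_left (norm_nonneg _) (ha t)
    _ ≤ ∫ t in (0 : ℝ)..1, ‖f t‖ :=
        intervalIntegral.integral_mono_interval le_rfl hx.1 hx.2
          (Filter.Eventually.of_forall fun _ => norm_nonneg _) hint

theorem norm_le_of_ae_bound (u : EdgeL2) {C : ℝ} (hC : 0 ≤ C)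
    (h : ∀ᵐ x ∂((volume : Measure ℝ).restrict (Icc 0 1)), ‖u x‖ ≤ C) : ‖u‖ ≤ C := by
  simpa [measureUnivNNReal] using Lp.norm_le_of_ae_bound hC h

/-- `v` is almost everywhere equal to an absolutely continuous function with derivative `v'` and
boundary values `c` and `d`. -/
def HasDeriv (v v' : EdgeL2) (c d : ℂ) : Prop :=
  (∀ᵐ x ∂((volume : Measure ℝ).restrict (Icc 0 1)), v x = c + ∫ t in (0 : ℝ)..x, v' t) ∧
    d = c + ∫ t in (0 : ℝ)..1, v' t

/-- Trace estimate: write `c = v x - ∫ v'` and average over `x`. It is what makes the vertex values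
of an `H¹` function square summable. -/
theorem HasDeriv.norm_le {v v' : EdgeL2} {c d : ℂ} (h : v.HasDeriv v' c d) :
    ‖c‖ ≤ ‖v‖ + ‖v'‖ := by
  have h1 : ∀ᵐ x ∂((volume : Measure ℝ).restrict (Icc 0 1)), ‖c‖ ≤ ‖v x‖ + ‖v'‖ := by
    filter_upwards [h.1, ae_restrict_mem measurableSet_Icc] with x hx hm
    have h2 : c = v x - ∫ t in (0 : ℝ)..x, v' t := by rw [hx]; ring
    have h3 := v'.norm_integral_mul_le (a := fun _ => 1) hm (by simp)
    simp only [one_mul] at h3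
    calc ‖c‖ = ‖v x - ∫ t in (0 : ℝ)..x, v' t‖ := by rw [← h2]
      _ ≤ _ := (norm_sub_le _ _).trans (by gcongr)
  have hint : Integrable (fun x => ‖v x‖) ((volume : Measure ℝ).restrict (Icc 0 1)) :=
    v.integrableOn.norm
  have h4 := integral_mono_ae (integrable_const _) (hint.add (integrable_const ‖v'‖)) h1
  simp only [integral_const, Pi.add_apply] at h4
  rw [MeasureTheory.integral_add hint (integrable_const _)] at h4
  simp only [integral_const, probReal_univ, one_smul] at h4
  linarith [v.integral_norm_le]

theorem HasDeriv.exists_isPrimitive {v v' : EdgeL2} {c d : ℂ} (h : v.HasDeriv v' c d) :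
    ∃ V : ℝ → ℂ, IsPrimitive V v' ∧ V 0 = c ∧ V 1 = d ∧
      ∀ᵐ x ∂((volume : Measure ℝ).restrict (Icc 0 1)), v x = V x := by
  refine ⟨fun x => c + ∫ t in (0 : ℝ)..x, v' t, ?_, by simp, h.2.symm, h.1⟩
  simpa using (IsPrimitive.const c).add
    (IsPrimitive.of_integral (v'.intervalIntegrable (x := 1) (by simp)))

theorem inner_eq (v w : EdgeL2) :
    ⟪v, w⟫_ℂ = ∫ t in (0 : ℝ)..1, (starRingEnd ℂ) (v t) * w t := by
  rw [L2.inner_def, intervalIntegral.integral_of_le zero_le_one, integral_Icc_eq_integral_Ioc]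
  simp [mul_comm]

theorem intervalIntegrable_conj_mul (v w : EdgeL2) :
    IntervalIntegrable (fun t => (starRingEnd ℂ) (v t) * w t) volume 0 1 := by
  rw [intervalIntegrable_iff_integrableOn_Icc_of_le zero_le_one]
  have := L2.integrable_inner (𝕜 := ℂ) v w
  refine this.congr (Filter.Eventually.of_forall fun t => ?_)
  simp [mul_comm]

theorem ae_of_ae_restrict {P : ℝ → Prop}
    (h : ∀ᵐ x ∂((volume : Measure ℝ).restrict (Icc 0 1)), P x) :
    ∀ᵐ x, x ∈ uIcc (0 : ℝ) 1 → P x := by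
  rw [uIcc_of_le zero_le_one]
  exact (ae_restrict_iff' measurableSet_Icc).1 h

/-- Green's formula on an edge. -/
theorem HasDeriv.inner_eq {v v' w g : EdgeL2} {c d : ℂ} (h : v.HasDeriv v' c d) {W G : ℝ → ℂ}
    (hW : IsPrimitive W G)
    (hw : ∀ᵐ x ∂((volume : Measure ℝ).restrict (Icc 0 1)), w x = W x)
    (hg : ∀ᵐ x ∂((volume : Measure ℝ).restrict (Icc 0 1)), g x = -G x) :
    ⟪v', w⟫_ℂ = ⟪v, g⟫_ℂ + (starRingEnd ℂ) d * W 1 - (starRingEnd ℂ) c * W 0 := by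
  obtain ⟨V, hV, rfl, rfl, hv⟩ := h.exists_isPrimitive
  have key := hV.integral_conj_mul hW
  have e : ∫ t in (0 : ℝ)..1, ((starRingEnd ℂ) (v' t) * W t + (starRingEnd ℂ) (V t) * G t) =
      ⟪v', w⟫_ℂ - ⟪v, g⟫_ℂ := by
    rw [EdgeL2.inner_eq, EdgeL2.inner_eq, ← intervalIntegral.integral_sub
      (intervalIntegrable_conj_mul _ _) (intervalIntegrable_conj_mul _ _)]
    refine intervalIntegral.integral_congr_ae ?_
    filter_upwards [ae_of_ae_restrict hv, ae_of_ae_restrict hw, ae_of_ae_restrict hg]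
      with x h1 h2 h3 hx
    have hx' := uIoc_subset_uIcc hx
    rw [h1 hx', h2 hx', h3 hx']
    ring
  rw [e] at key
  linear_combination key

theorem _root_.IsPrimitive.hasDeriv {u w : EdgeL2} {U W : ℝ → ℂ} (hU : IsPrimitive U W)
    (hu : ∀ᵐ x ∂((volume : Measure ℝ).restrict (Icc 0 1)), u x = U x)
    (hw : ∀ᵐ x ∂((volume : Measure ℝ).restrict (Icc 0 1)), w x = W x) :
    u.HasDeriv w (U 0) (U 1) := by
  have h := hU.congr_deriv (g := w) (by
    filter_upwards [ae_of_ae_restrict hw] with x hx hm using (hx hm).symm)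
  refine ⟨?_, h.eq_add_integral (by simp)⟩
  filter_upwards [hu, ae_restrict_mem measurableSet_Icc] with x hx hm
  rw [hx, h.eq_add_integral hm]

theorem isPrimitive_cos (k : ℝ) :
    IsPrimitive (fun x => (Real.cos (k * x) : ℂ)) (fun x => -k * (Real.sin (k * x) : ℂ)) := by
  refine .of_contDiff (Complex.ofRealCLM.contDiff.comp (f := fun x : ℝ => Real.cos (k * x)) (by fun_prop)) fun x => ?_
  have h := ((hasDerivAt_id x).const_mul k).cos.ofReal_comp
  refine h.congr_deriv ?_
  push_cast [id]
  ring

theorem isPrimitive_sin (k : ℝ) :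
    IsPrimitive (fun x => (Real.sin (k * x) : ℂ)) (fun x => k * (Real.cos (k * x) : ℂ)) := by
  refine .of_contDiff (Complex.ofRealCLM.contDiff.comp (f := fun x : ℝ => Real.sin (k * x)) (by fun_prop)) fun x => ?_
  have h := ((hasDerivAt_id x).const_mul k).sin.ofReal_comp
  refine h.congr_deriv ?_
  push_cast [id]
  ring

/-- The solution of `-u'' - k² u = f` on an edge with given boundary values; the last
clause is the weak form of the equation, with the boundary values of the derivative. -/
theorem exists_solution {k : ℝ} (hk : 0 < k) (hs : Real.sin k ≠ 0) :
    ∃ C : ℝ, 0 ≤ C ∧ ∀ f : EdgeL2, ∃ P Q : ℂ, ‖P‖ ≤ C * ‖f‖ ∧ ‖Q‖ ≤ C * ‖f‖ ∧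
      ∀ a b : ℂ, ∃ u w : EdgeL2, ‖u‖ ≤ C * (‖f‖ + ‖a‖ + ‖b‖) ∧ ‖w‖ ≤ C * (‖f‖ + ‖a‖ + ‖b‖) ∧
        u.HasDeriv w a b ∧ ∀ (v v' : EdgeL2) (c d : ℂ), v.HasDeriv v' c d →
          ⟪v', w⟫_ℂ = ⟪v, f + ((k ^ 2 : ℝ) : ℂ) • u⟫_ℂ +
            (starRingEnd ℂ) d * (k / Real.sin k * (b * Real.cos k - a) + Q) -
            (starRingEnd ℂ) c * (k / Real.sin k * (b - a * Real.cos k) + P) := by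
  set S : ℝ := ‖((Real.sin k : ℝ) : ℂ)⁻¹‖ with hS
  have hS0 : 0 ≤ S := norm_nonneg _
  have hcos1 : ∀ x, ‖(Real.cos x : ℂ)‖ ≤ 1 := fun x => by
    rw [Complex.norm_real]; exact Real.abs_cos_le_one x
  have hsin1 : ∀ x, ‖(Real.sin x : ℂ)‖ ≤ 1 := fun x => by
    rw [Complex.norm_real]; exact Real.abs_sin_le_one x
  have hs' : ((Real.sin k : ℝ) : ℂ) ≠ 0 := by exact_mod_cast hs
  have hk' : (k : ℂ) ≠ 0 := by exact_mod_cast hk.ne'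
  have hknorm : ‖(k : ℂ)‖ = k := by rw [Complex.norm_real, Real.norm_of_nonneg hk.le]
  refine ⟨(1 + k) * (1 + k⁻¹) * (4 + 4 * S), by positivity, fun f => ?_⟩
  have hfi : IntervalIntegrable f volume 0 1 := f.intervalIntegrable (by simp)
  set Fc : ℝ → ℂ := fun x => ∫ t in (0 : ℝ)..x, (Real.cos (k * t) : ℂ) * f t with hFc
  set Fs : ℝ → ℂ := fun x => ∫ t in (0 : ℝ)..x, (Real.sin (k * t) : ℂ) * f t with hFs
  have hPc : IsPrimitive Fc (fun t => (Real.cos (k * t) : ℂ) * f t) :=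
    .of_integral (hfi.continuousOn_mul (by fun_prop))
  have hPs : IsPrimitive Fs (fun t => (Real.sin (k * t) : ℂ) * f t) :=
    .of_integral (hfi.continuousOn_mul (by fun_prop))
  have bFc : ∀ x ∈ Icc (0 : ℝ) 1, ‖Fc x‖ ≤ ‖f‖ := fun x hx =>
    f.norm_integral_mul_le hx fun t => hcos1 _
  have bFs : ∀ x ∈ Icc (0 : ℝ) 1, ‖Fs x‖ ≤ ‖f‖ := fun x hx =>
    f.norm_integral_mul_le hx fun t => hsin1 _
  have hFc0 : Fc 0 = 0 := by simp [hFc]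
  have hFs0 : Fs 0 = 0 := by simp [hFs]
  have mone : (1 : ℝ) ∈ Icc (0 : ℝ) 1 := by simp
  have hf0 := norm_nonneg f
  -- `P` and `Q` are the derivatives at `0` and `1` of the solution with zero boundary values.
  set P : ℂ := Fc 1 - Real.cos k * (Real.sin k : ℂ)⁻¹ * Fs 1 with hP
  set Q : ℂ := -((Real.sin k : ℂ)⁻¹ * Fs 1) with hQ
  have hbig : 1 + S ≤ (1 + k) * (1 + k⁻¹) * (4 + 4 * S) := by
    have h1 : 1 ≤ (1 + k) * (1 + k⁻¹) := by
      have : 0 < k⁻¹ := by positivity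
      nlinarith
    nlinarith
  have bP : ‖P‖ ≤ (1 + S) * ‖f‖ := by
    calc ‖P‖ ≤ ‖Fc 1‖ + ‖(Real.cos k : ℂ)‖ * S * ‖Fs 1‖ := by
          rw [hP, hS, ← norm_mul, ← norm_mul]; exact norm_sub_le _ _
      _ ≤ ‖f‖ + 1 * S * ‖f‖ := by
          gcongr
          exacts [bFc 1 mone, hcos1 k, bFs 1 mone]
      _ = _ := by ring
  have bQ : ‖Q‖ ≤ (1 + S) * ‖f‖ := by
    calc ‖Q‖ = S * ‖Fs 1‖ := by rw [hQ, norm_neg, norm_mul]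
      _ ≤ S * ‖f‖ := by gcongr; exact bFs 1 mone
      _ ≤ _ := by nlinarith
  refine ⟨P, Q, bP.trans (by gcongr), bQ.trans (by gcongr), fun a b => ?_⟩
  -- The initial slope `U'(0)` that forces `U 1 = b`; solving for it requires `sin k ≠ 0`.
  set c : ℂ := k * (Real.sin k : ℂ)⁻¹ * (b - a * Real.cos k) + P with hc
  have ha0 := norm_nonneg a
  have hb0 := norm_nonneg b
  set B : ℝ := ‖f‖ + ‖a‖ + ‖b‖ with hB
  have hB0 : 0 ≤ B := by positivity
  have bc : ‖c‖ ≤ (1 + k) * (1 + S) * B := by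
    calc ‖c‖ ≤ ‖(k : ℂ)‖ * S * (‖b‖ + ‖a‖ * ‖(Real.cos k : ℂ)‖) + ‖P‖ := by
          refine (norm_add_le _ _).trans ?_
          rw [norm_mul, norm_mul, ← norm_mul a]
          gcongr
          exact norm_sub_le _ _
      _ ≤ k * S * (‖b‖ + ‖a‖ * 1) + (1 + S) * ‖f‖ := by
          rw [hknorm]
          gcongr
          exact hcos1 k
      _ ≤ k * S * B + (1 + S) * B := by
          gcongr
          · rw [hB]; linarith
          · rw [hB]; linarith
      _ ≤ _ := by nlinarith [mul_nonneg hk.le hB0]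
  -- Variation of constants: `U x = a cos kx + (c/k) sin kx - (1/k) ∫₀ˣ sin (k(x - t)) f(t) dt`,
  -- with the kernel expanded by the addition formula; `W` is its derivative.
  set U : ℝ → ℂ := fun x => a * Real.cos (k * x) + (k : ℂ)⁻¹ * (c * Real.sin (k * x)
    - (Real.sin (k * x) * Fc x - Real.cos (k * x) * Fs x)) with hU
  set W : ℝ → ℂ := fun x => -(k * (a * Real.sin (k * x))) + c * Real.cos (k * x)
    - (Real.cos (k * x) * Fc x + Real.sin (k * x) * Fs x) with hW
  have hcosP := isPrimitive_cos k
  have hsinP := isPrimitive_sin k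
  have hUW : IsPrimitive U W := by
    have h := (hcosP.const_mul a).add (((hsinP.const_mul c).add
      (((hsinP.mul hPc).add ((hcosP.mul hPs).const_mul (-1))).const_mul (-1))).const_mul
      ((k : ℂ)⁻¹))
    refine (h.congr fun x => by simp only [hU]; ring).congr_deriv (Filter.Eventually.of_forall fun x _ => ?_)
    simp only [hW]
    field_simp
    ring
  set G : ℝ → ℂ := fun x => -((k ^ 2 : ℝ) : ℂ) * U x - f x with hG
  have hWG : IsPrimitive W G := by
    have h := (((hsinP.const_mul a).const_mul (-k)).add (hcosP.const_mul c)).add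
      (((hcosP.mul hPc).add (hsinP.mul hPs)).const_mul (-1))
    refine (h.congr fun x => by simp only [hW]; ring).congr_deriv (Filter.Eventually.of_forall fun x _ => ?_)
    have hpy : (Real.sin (k * x) : ℂ) ^ 2 + (Real.cos (k * x) : ℂ) ^ 2 = 1 := by
      exact_mod_cast Real.sin_sq_add_cos_sq (k * x)
    simp only [hG, hU]
    rw [Complex.ofReal_pow]
    linear_combination (-f x) * hpy + k * (c * Real.sin (k * x)
      - (Real.sin (k * x) * Fc x - Real.cos (k * x) * Fs x)) * mul_inv_cancel₀ hk'
  have hu := hUW.memLp.coeFn_toLp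
  have hw := hWG.memLp.coeFn_toLp
  have hpy : (Real.sin k : ℂ) ^ 2 + (Real.cos k : ℂ) ^ 2 = 1 := by
    exact_mod_cast Real.sin_sq_add_cos_sq k
  have hU0 : U 0 = a := by simp [hU, hFs0]
  have hU1 : U 1 = b := by
    simp only [hU, hc, hP, mul_one]
    field_simp
    ring
  have hW0 : W 0 = k / Real.sin k * (b - a * Real.cos k) + P := by
    simp [hW, hFc0, hc, div_eq_mul_inv]
  have hW1 : W 1 = k / Real.sin k * (b * Real.cos k - a) + Q := by
    simp only [hW, hc, hP, hQ, mul_one]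
    field_simp
    linear_combination (-(a * k) - Fs 1) * hpy
  refine ⟨hUW.memLp.toLp _, hWG.memLp.toLp _, ?_, ?_, ?_, ?_⟩
  · refine norm_le_of_ae_bound _ (by positivity) ?_
    filter_upwards [hu, ae_restrict_mem measurableSet_Icc] with x hx hm
    rw [hx]
    calc ‖U x‖ ≤ ‖a‖ * ‖(Real.cos (k * x) : ℂ)‖ + ‖(k : ℂ)⁻¹‖ * (‖c‖ * ‖(Real.sin (k * x) : ℂ)‖ +
          (‖(Real.sin (k * x) : ℂ)‖ * ‖Fc x‖ + ‖(Real.cos (k * x) : ℂ)‖ * ‖Fs x‖)) := by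
          simp only [← norm_mul]
          refine (norm_add_le _ _).trans ?_
          gcongr ?_ + ?_
          · rfl
          · rw [norm_mul]
            gcongr
            refine (norm_sub_le _ _).trans ?_
            gcongr
            exact norm_sub_le _ _
      _ ≤ ‖a‖ * 1 + k⁻¹ * ((1 + k) * (1 + S) * B * 1 + (1 * ‖f‖ + 1 * ‖f‖)) := by
          rw [norm_inv, hknorm]
          gcongr
          exacts [hcos1 _, hsin1 _, hsin1 _, bFc x hm, hcos1 _, bFs x hm]
      _ ≤ B + k⁻¹ * ((1 + k) * (1 + S) * B + 2 * B) := by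
          have : ‖f‖ ≤ B := by rw [hB]; linarith
          have : ‖a‖ ≤ B := by rw [hB]; linarith
          have : 0 < k⁻¹ := by positivity
          gcongr ?_ + ?_ * ?_ <;> linarith
      _ ≤ (1 + k) * (1 + k⁻¹) * (4 + 4 * S) * B := by
          have h1 : 0 < k⁻¹ := by positivity
          have h2 : k * k⁻¹ = 1 := mul_inv_cancel₀ hk.ne'
          have : (1 + k) * (1 + k⁻¹) * (4 + 4 * S) * B -
            (B + k⁻¹ * ((1 + k) * (1 + S) * B + 2 * B)) =
            B * (6 + 7 * S + k * (4 + 4 * S) + k⁻¹ * (1 + 3 * S)) := by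
              linear_combination (B * (3 + 3 * S)) * h2
          have h3 : 0 ≤ B * (6 + 7 * S + k * (4 + 4 * S) + k⁻¹ * (1 + 3 * S)) := by positivity
          linarith
  · refine norm_le_of_ae_bound _ (by positivity) ?_
    filter_upwards [hw, ae_restrict_mem measurableSet_Icc] with x hx hm
    rw [hx]
    calc ‖W x‖ ≤ ‖(k : ℂ)‖ * (‖a‖ * ‖(Real.sin (k * x) : ℂ)‖) + ‖c‖ * ‖(Real.cos (k * x) : ℂ)‖ +
          (‖(Real.cos (k * x) : ℂ)‖ * ‖Fc x‖ + ‖(Real.sin (k * x) : ℂ)‖ * ‖Fs x‖) := by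
          simp only [← norm_mul]
          refine (norm_sub_le _ _).trans ?_
          gcongr ?_ + ?_
          · refine (norm_add_le _ _).trans ?_
            rw [norm_neg]
          · exact norm_add_le _ _
      _ ≤ k * (‖a‖ * 1) + (1 + k) * (1 + S) * B * 1 + (1 * ‖f‖ + 1 * ‖f‖) := by
          rw [hknorm]
          gcongr
          exacts [hsin1 _, hcos1 _, hcos1 _, bFc x hm, hsin1 _, bFs x hm]
      _ ≤ k * B + (1 + k) * (1 + S) * B + 2 * B := by
          have h1 : ‖f‖ ≤ B := by rw [hB]; linarith
          have h2 : ‖a‖ ≤ B := by rw [hB]; linarith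
          have := mul_le_mul_of_nonneg_left h2 hk.le
          linarith
      _ ≤ (1 + k) * (1 + k⁻¹) * (4 + 4 * S) * B := by
          have h1 : 0 < k⁻¹ := by positivity
          have h2 : k * k⁻¹ = 1 := mul_inv_cancel₀ hk.ne'
          have : (1 + k) * (1 + k⁻¹) * (4 + 4 * S) * B -
            (k * B + (1 + k) * (1 + S) * B + 2 * B) =
            B * (5 + 7 * S + k * (2 + 3 * S) + k⁻¹ * (4 + 4 * S)) := by
              linear_combination (B * (4 + 4 * S)) * h2
          have h3 : 0 ≤ B * (5 + 7 * S + k * (2 + 3 * S) + k⁻¹ * (4 + 4 * S)) := by positivity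
          linarith
  · have := hUW.hasDeriv hu hw
    rwa [hU0, hU1] at this
  · intro v v' c' d' hv
    have key := hv.inner_eq (g := f + ((k ^ 2 : ℝ) : ℂ) • hUW.memLp.toLp U) hWG hw (by
      filter_upwards [Lp.coeFn_add f (((k ^ 2 : ℝ) : ℂ) • hUW.memLp.toLp U),
        Lp.coeFn_smul ((k ^ 2 : ℝ) : ℂ) (hUW.memLp.toLp U), hu] with x h1 h2 h3
      rw [h1, Pi.add_apply, h2, Pi.smul_apply, h3, smul_eq_mul]
      simp only [hG]
      ring)
    rw [key, hW0, hW1]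

/-- The eigenfunction `sin (2 π m x)` on a loop. -/
theorem exists_eigenfunction {m : ℕ} (hm : m ≠ 0) :
    ∃ u w : EdgeL2, u ≠ 0 ∧ u.HasDeriv w 0 0 ∧ ∃ p : ℂ, ∀ (v v' : EdgeL2) (c d : ℂ),
      v.HasDeriv v' c d → ⟪v', w⟫_ℂ = ⟪v, (((2 * Real.pi * m) ^ 2 : ℝ) : ℂ) • u⟫_ℂ +
        (starRingEnd ℂ) d * p - (starRingEnd ℂ) c * p := by
  set k : ℝ := 2 * Real.pi * m with hk
  have hk0 : (k : ℂ) ≠ 0 := by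
    have : 0 < k := by positivity
    exact_mod_cast this.ne'
  have hcos : Real.cos k = 1 := by rw [hk, mul_comm]; exact Real.cos_nat_mul_two_pi m
  have hsin : Real.sin k = 0 := by
    have h := Real.sin_nat_mul_pi (m * 2)
    push_cast at h
    rw [← h, hk]
    ring_nf
  have hUW := isPrimitive_sin k
  have hWG := (isPrimitive_cos k).const_mul k
  have hu := hUW.memLp.coeFn_toLp
  have hw := hWG.memLp.coeFn_toLp
  have hd := hUW.hasDeriv hu hw
  simp only [mul_zero, mul_one, Real.sin_zero, hsin, Complex.ofReal_zero] at hd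
  have hgreen : ∀ (v v' : EdgeL2) (c d : ℂ),
      v.HasDeriv v' c d → ⟪v', hWG.memLp.toLp _⟫_ℂ = ⟪v, ((k ^ 2 : ℝ) : ℂ) • hUW.memLp.toLp _⟫_ℂ +
        (starRingEnd ℂ) d * k - (starRingEnd ℂ) c * k := by
    intro v v' c d hv
    have key := hv.inner_eq (g := ((k ^ 2 : ℝ) : ℂ) • hUW.memLp.toLp _) hWG hw (by
      filter_upwards [Lp.coeFn_smul ((k ^ 2 : ℝ) : ℂ) (hUW.memLp.toLp _), hu] with x h2 h3
      rw [h2, Pi.smul_apply, h3, smul_eq_mul]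
      push_cast
      ring)
    rw [key]
    simp [hcos]
  -- The derivative of `sin (kx)` equals `k` at both ends, so the same `p = k` serves for both
  -- boundary terms.
  refine ⟨_, _, ?_, hd, k, hgreen⟩
  intro h0
  have h1 := hgreen (hUW.memLp.toLp _) (hWG.memLp.toLp _) 0 0 hd
  rw [h0] at h1
  simp only [smul_zero, inner_zero_right, map_zero, zero_mul, sub_zero, add_zero] at h1
  rw [inner_self_eq_zero] at h1
  -- If `u = 0`, Green's formula gives `w = 0`; the trace estimate for `w`, whose derivative is `-k²
  -- u` and whose value at `0` is `k`, then forces `k = 0`.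
  have h2 := hWG.hasDeriv hw (w := ((-k ^ 2 : ℝ) : ℂ) • hUW.memLp.toLp _) (by
    filter_upwards [Lp.coeFn_smul ((-k ^ 2 : ℝ) : ℂ) (hUW.memLp.toLp _), hu] with x h2 h3
    rw [h2, Pi.smul_apply, h3, smul_eq_mul]
    push_cast
    ring)
  have h3 := h2.norm_le
  rw [h0, h1] at h3
  simp at h3
  exact hk0 (by exact_mod_cast h3)

end EdgeL2

/-! ### Square summable families and the difference equation -/

theorem memℓp_two_iff {α : Type*} {E : α → Type*} [∀ i, NormedAddCommGroup (E i)]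
    {f : ∀ i, E i} : Memℓp f 2 ↔ Summable fun i => ‖f i‖ ^ 2 := by
  simpa using memℓp_gen_iff (p := 2) (f := f) (by norm_num)

theorem Memℓp.comp_equiv {α β E : Type*} [NormedAddCommGroup E] {f : α → E} (hf : Memℓp f 2)
    (σ : β ≃ α) : Memℓp (fun i => f (σ i)) 2 := by
  rw [memℓp_two_iff] at hf ⊢
  exact (Equiv.summable_iff σ).2 hf

theorem Memℓp.comp_fst {α J E : Type*} [Finite J] [NormedAddCommGroup E] {f : α → E}
    (hf : Memℓp f 2) : Memℓp (fun p : α × J => f p.1) 2 := by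
  have := Fintype.ofFinite J
  rw [memℓp_two_iff] at hf ⊢
  rw [summable_prod_of_nonneg (fun _ => by positivity)]
  refine ⟨fun _ => .of_finite, ?_⟩
  simpa using hf.mul_left (Fintype.card J : ℝ)

theorem Memℓp.comp_prodMk {α J E : Type*} [NormedAddCommGroup E] {f : α × J → E}
    (hf : Memℓp f 2) (j : J) : Memℓp (fun a => f (a, j)) 2 := by
  rw [memℓp_two_iff] at hf ⊢
  exact hf.comp_injective (Prod.mk_left_injective j)

theorem Memℓp.summable_mul_two {α : Type*} {f g : α → ℂ} (hf : Memℓp f 2) (hg : Memℓp g 2) :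
    Summable fun i => (starRingEnd ℂ) (f i) * g i := by
  have := lp.summable_inner (𝕜 := ℂ) (⟨f, hf⟩ : lp (fun _ : α => ℂ) 2) ⟨g, hg⟩
  refine this.congr fun i => ?_
  simp [mul_comm]

/-- Composition with a permutation, as an isometry of `ℓ²`. -/
noncomputable def lpCompEquiv {α : Type*} (σ : Equiv.Perm α) :
    lp (fun _ : α => ℂ) 2 →ₗᵢ[ℂ] lp (fun _ : α => ℂ) 2 where
  toFun φ := ⟨fun i => φ (σ i), (lp.memℓp φ).comp_equiv σ⟩
  map_add' _ _ := rfl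
  map_smul' _ _ := rfl
  norm_map' φ := by
    rw [lp.norm_eq_tsum_rpow (by norm_num), lp.norm_eq_tsum_rpow (by norm_num)]
    congr 1
    exact Equiv.tsum_eq σ fun i => ‖φ i‖ ^ _

/-- A diagonally dominant difference equation is solvable in `ℓ²`. -/
theorem exists_solution_differenceEquation {Γ ι : Type*} [AddCommGroup Γ] [Fintype ι] (g : ι → Γ)
    {D : ℝ} (hD : 2 * Fintype.card ι < D) {h : Γ → ℂ} (hh : Memℓp h 2) :
    ∃ φ : Γ → ℂ, Memℓp φ 2 ∧ ∀ γ, D * φ γ + ∑ i, (φ (γ - g i) + φ (g i + γ)) = h γ := by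
  have hD0 : 0 < D := lt_of_le_of_lt (by positivity) hD
  let τ : Γ → lp (fun _ : Γ => ℂ) 2 →L[ℂ] lp (fun _ : Γ => ℂ) 2 := fun x =>
    (lpCompEquiv (Equiv.addLeft x)).toContinuousLinearMap
  have hτ : ∀ x, ‖τ x‖ ≤ 1 := fun x => LinearIsometry.norm_toContinuousLinearMap_le _
  let B := ∑ i, (τ (-g i) + τ (g i))
  have hB : ‖B‖ ≤ 2 * Fintype.card ι := by
    calc ‖B‖ ≤ ∑ _i : ι, (1 + 1 : ℝ) := norm_sum_le_of_le _ fun i _ =>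
          (norm_add_le _ _).trans (add_le_add (hτ _) (hτ _))
      _ = _ := by simp; ring
  -- `D + B = D (1 - (-D⁻¹ B))`, and `‖D⁻¹ B‖ < 1` because each of the `2r` translations has norm at
  -- most one.
  have hunit : IsUnit (1 - (-((D : ℂ)⁻¹ • B))) := by
    refine isUnit_one_sub_of_norm_lt_one ?_
    rw [norm_neg, norm_smul, norm_inv, Complex.norm_real, Real.norm_of_nonneg hD0.le,
      inv_mul_lt_one₀ hD0]
    exact hB.trans_lt hD
  obtain ⟨T, hT⟩ := hunit
  have hDc : (D : ℂ) ≠ 0 := by exact_mod_cast hD0.ne'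
  let ψ : lp (fun _ : Γ => ℂ) 2 := ⟨h, hh⟩
  let φ := (↑T⁻¹ : lp (fun _ : Γ => ℂ) 2 →L[ℂ] lp (fun _ : Γ => ℂ) 2) ((D : ℂ)⁻¹ • ψ)
  have hφ : (T : lp (fun _ : Γ => ℂ) 2 →L[ℂ] lp (fun _ : Γ => ℂ) 2) φ = (D : ℂ)⁻¹ • ψ := by
    rw [← mul_apply_eq_comp, Units.mul_inv]; rfl
  refine ⟨φ, lp.memℓp φ, fun γ => ?_⟩
  have h1 : (D : ℂ) • φ + B φ = ψ := by
    have h2 := congrArg (fun x => (D : ℂ) • x) hφ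
    simp only [hT] at h2
    simpa [smul_smul, hDc] using h2
  have h3 := congrArg (fun x : lp (fun _ : Γ => ℂ) 2 => x γ) h1
  simp only [lp.coeFn_add, Pi.add_apply, lp.coeFn_smul, Pi.smul_apply, smul_eq_mul, B,
    sum_apply, lp.coeFn_sum, Finset.sum_apply,
    add_apply] at h3
  simp only [sub_eq_neg_add]
  exact h3

/-! ### Spectra of unbounded operators -/

section Operator

variable {H : Type*} [NormedAddCommGroup H]

/-- If `R` inverts `T - z`, then `T - y = (1 - (y - z) R)(T - z)`, and the first factor is
invertible for `y` near `z` by the Neumann series. -/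
theorem isClosed_unboundedSpectrum [NormedSpace ℂ H] [CompleteSpace H] (T : H →ₗ.[ℂ] H) :
    IsClosed (unboundedSpectrum T) := by
  rw [← isOpen_compl_iff, Metric.isOpen_iff]
  intro z hz
  simp only [unboundedSpectrum, mem_compl_iff, mem_ofPred_eq, not_not] at hz
  obtain ⟨R, hR1, hR2⟩ := hz
  refine ⟨(‖R‖ + 1)⁻¹, by positivity, fun y hy => ?_⟩
  simp only [unboundedSpectrum, mem_compl_iff, mem_ofPred_eq, not_not]
  rw [Metric.mem_ball, dist_eq_norm] at hy
  have hlt : ‖(y - z) • R‖ < 1 := by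
    rw [norm_smul]
    have h1 : ‖y - z‖ * (‖R‖ + 1) < 1 := by
      rwa [← lt_inv_mul_iff₀' (by positivity), mul_one]
    nlinarith [norm_nonneg (y - z)]
  obtain ⟨S, hS⟩ := isUnit_one_sub_of_norm_lt_one hlt
  have hS' : ∀ x, (S : H →L[ℂ] H) x = x - (y - z) • R x := fun x => by rw [hS]; rfl
  have hinv1 : ∀ x, (↑S⁻¹ : H →L[ℂ] H) ((S : H →L[ℂ] H) x) = x := fun x => by
    rw [← mul_apply_eq_comp, Units.inv_mul]; rfl
  have hinv2 : ∀ x, (S : H →L[ℂ] H) ((↑S⁻¹ : H →L[ℂ] H) x) = x := fun x => by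
    rw [← mul_apply_eq_comp, Units.mul_inv]; rfl
  refine ⟨R * (↑S⁻¹ : H →L[ℂ] H), fun u => ?_, fun f => ?_⟩
  · have h1 : T u - y • (u : H) = (S : H →L[ℂ] H) (T u - z • (u : H)) := by
      rw [hS', hR1, sub_smul]; abel
    rw [mul_apply_eq_comp, h1, hinv1, hR1]
  · obtain ⟨h, h1⟩ := hR2 ((↑S⁻¹ : H →L[ℂ] H) f)
    refine ⟨h, ?_⟩
    have h2 := hinv2 f
    rw [hS'] at h2
    calc T ⟨R ((↑S⁻¹ : H →L[ℂ] H) f), h⟩ - y • R ((↑S⁻¹ : H →L[ℂ] H) f) = (T ⟨_, h⟩ - z • R ((↑S⁻¹ : H →L[ℂ] H) f)) -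
          (y - z) • R ((↑S⁻¹ : H →L[ℂ] H) f) := by rw [sub_smul]; abel
      _ = f := by rw [h1, h2]

theorem mem_unboundedSpectrum_of_eigenvector [NormedSpace ℂ H] {T : H →ₗ.[ℂ] H} {z : ℂ} {u : H}
    (hu : u ≠ 0) (h : (u, z • u) ∈ T.graph) : z ∈ unboundedSpectrum T := by
  rintro ⟨R, hR, -⟩
  obtain ⟨x, hx, hTx⟩ := (LinearPMap.mem_graph_iff T).1 h
  simp only at hx hTx
  have := hR x
  rw [hTx, hx, sub_self, map_zero] at this
  exact hu this.symm

/-- A real number `z` is not in the spectrum of a symmetric operator `T` if `T - z` is onto. -/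
theorem notMem_unboundedSpectrum_of_surjective [InnerProductSpace ℂ H] [CompleteSpace H]
    {T : H →ₗ.[ℂ] H} (hT : ∀ p ∈ T.graph, ∀ q ∈ T.graph, ⟪p.1, q.2⟫_ℂ = ⟪p.2, q.1⟫_ℂ) (z : ℝ)
    (h : ∀ f, ∃ u, (u, f + (z : ℂ) • u) ∈ T.graph) : (z : ℂ) ∉ unboundedSpectrum T := by
  choose R hR using h
  have hsymm : ∀ u f v k, (u, f + (z : ℂ) • u) ∈ T.graph → (v, k + (z : ℂ) • v) ∈ T.graph →
      ⟪u, k⟫_ℂ = ⟪f, v⟫_ℂ := by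
    intro u f v k hu hv
    have := hT _ hu _ hv
    simp only [inner_add_left, inner_add_right, inner_smul_left, inner_smul_right,
      Complex.conj_ofReal] at this
    exact add_right_cancel this
  -- Injectivity follows from surjectivity: a vector `d` killed by `T - z` is paired with a preimage
  -- of `d` itself, giving `⟪d, d⟫ = 0` by symmetry.
  have huniq : ∀ u f, (u, f + (z : ℂ) • u) ∈ T.graph → u = R f := by
    intro u f hu
    have hmem := T.graph.sub_mem hu (hR f)
    have e : (u, f + (z : ℂ) • u) - (R f, f + (z : ℂ) • R f) =
        (u - R f, (0 : H) + (z : ℂ) • (u - R f)) := by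
      simp [smul_sub]
    rw [e] at hmem
    have := hsymm _ _ _ _ hmem (hR (u - R f))
    rw [inner_zero_left, inner_self_eq_zero, sub_eq_zero] at this
    exact this
  let L : H →ₗ[ℂ] H :=
    { toFun := R
      map_add' := fun f k => by
        refine (huniq _ _ ?_).symm
        convert! T.graph.add_mem (hR f) (hR k) using 1
        ext <;> simp [smul_add]; abel
      map_smul' := fun c f => by
        refine (huniq _ _ ?_).symm
        convert! T.graph.smul_mem c (hR f) using 1
        ext <;> simp [smul_add, smul_comm c] }
  -- The inverse is symmetric and everywhere defined, hence bounded by the Hellinger–Toeplitz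
  -- theorem.
  have hL : L.IsSymmetric := fun f k => hsymm _ _ _ _ (hR f) (hR k)
  intro hz
  refine hz ⟨⟨L, hL.continuous⟩, fun u => ?_, fun f => ?_⟩
  · refine (huniq _ _ ?_).symm
    rw [sub_add_cancel]
    exact T.mem_graph u
  · obtain ⟨x, hx, hTx⟩ := (LinearPMap.mem_graph_iff T).1 (hR f)
    simp only at hx hTx
    have hdom : R f ∈ T.domain := hx ▸ x.2
    refine ⟨hdom, ?_⟩
    have e : (⟨R f, hdom⟩ : T.domain) = x := Subtype.ext hx.symm
    change T ⟨R f, hdom⟩ - (z : ℂ) • R f = f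
    rw [e, hTx, add_sub_cancel_right]

end Operator

/-- A point in the complement of a closed set that lies between points of the set lies in a
bounded component of the complement. -/
theorem exists_gap {S : Set ℝ} (hS : IsClosed S) {s t x : ℝ} (hs : s ∈ S) (ht : t ∈ S)
    (hsx : s ≤ x) (hxt : x ≤ t) (hx : x ∉ S) :
    ∃ a b, s ≤ a ∧ a < b ∧ b ≤ t ∧ a ∈ S ∧ b ∈ S ∧ ∀ y ∈ Ioo a b, y ∉ S := by
  have hA : IsCompact (S ∩ Icc s x) := isCompact_Icc.inter_left hS
  have hB : IsCompact (S ∩ Icc x t) := isCompact_Icc.inter_left hS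
  obtain ⟨a, ha, hamax⟩ := hA.exists_isGreatest ⟨s, hs, le_rfl, hsx⟩
  obtain ⟨b, hb, hbmin⟩ := hB.exists_isLeast ⟨t, ht, hxt, le_rfl⟩
  have hax : a < x := lt_of_le_of_ne ha.2.2 fun h => hx (h ▸ ha.1)
  have hxb : x < b := lt_of_le_of_ne hb.2.1 fun h => hx (h ▸ hb.1)
  refine ⟨a, b, ha.2.1, hax.trans hxb, hb.2.2, ha.1, hb.1, fun y hy hyS => ?_⟩
  rcases le_total y x with h | h
  · exact absurd (hamax ⟨hyS, ha.2.1.trans hy.1.le, h⟩) (not_le.2 hy.1)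
  · exact absurd (hbmin ⟨hyS, h, hy.2.le.trans hb.2.2⟩) (not_le.2 hy.2)

/-! ### The Laplacian of a metric graph: symmetry, vertex values, loop eigenvalues -/

theorem EdgeL2.hasDeriv_zero : (0 : EdgeL2).HasDeriv 0 0 0 := by
  refine ⟨?_, by rw [EdgeL2.integral_zero (by simp), add_zero]⟩
  filter_upwards [Lp.coeFn_zero ℂ 2 ((volume : Measure ℝ).restrict (Icc 0 1)),
    ae_restrict_mem measurableSet_Icc] with x h1 hx
  rw [h1, EdgeL2.integral_zero hx, add_zero, Pi.zero_apply]

namespace UnitMetricGraph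

variable {V E : Type*} (X : UnitMetricGraph V E)

theorem laplacian_symmetric : ∀ p ∈ X.laplacian.graph, ∀ q ∈ X.laplacian.graph,
    ⟪p.1, q.2⟫_ℂ = ⟪p.2, q.1⟫_ℂ := by
  rw [laplacian_graph]
  rintro p ⟨w, hw, hp⟩ q ⟨w', hw', hq⟩
  rw [← hq _ _ hw, ← inner_conj_symm p.2, ← hp _ _ hw', inner_conj_symm]

/-- Each vertex value is controlled by the trace estimate on a chosen edge `s x` starting there;
distinct vertices use distinct edges, so the bounds are square summable. -/
theorem memℓp_of_hasDeriv {v v' : GraphL2 E} {φ : V → ℂ}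
    (h : ∀ e, (v e).HasDeriv (v' e) (φ (X.src e)) (φ (X.tgt e)))
    {s : V → E} (hs : ∀ x, X.src (s x) = x) : Memℓp φ 2 := by
  have hinj : Function.Injective s := fun x y hxy => by rw [← hs x, hxy, hs]
  have key : ∀ f : GraphL2 E, Memℓp (fun x => ‖f (s x)‖) 2 := fun f => by
    rw [memℓp_two_iff]
    simpa [Function.comp_def] using (memℓp_two_iff.1 (lp.memℓp f)).comp_injective hinj
  refine ((key v).add (key v')).mono fun x => ?_
  have := (h (s x)).norm_le
  rwa [hs] at this

/-- The loop eigenfunction is extended by zero. In Green's formula the two boundary terms cancel,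
since both ends of the loop are the same vertex. -/
theorem mem_spectrum_of_loop {e : E} (he : X.src e = X.tgt e) {m : ℕ} (hm : m ≠ 0) :
    (((2 * Real.pi * m) ^ 2 : ℝ) : ℂ) ∈ unboundedSpectrum X.laplacian := by
  classical
  obtain ⟨u, w, hu, huw, p, hp⟩ := EdgeL2.exists_eigenfunction hm
  refine mem_unboundedSpectrum_of_eigenvector (u := lp.single 2 e u) ?_ ?_
  · intro h
    have := congrArg (fun x : GraphL2 E => x e) h
    simp only [lp.single_apply_self, lp.coeFn_zero, Pi.zero_apply] at this
    exact hu this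
  · rw [laplacian_graph]
    refine ⟨lp.single 2 e w, ⟨0, fun e' => ?_⟩, ?_⟩
    · by_cases h : e' = e
      · subst h
        rw [lp.single_apply_self, lp.single_apply_self]
        exact huw
      · rw [lp.single_apply_ne _ _ _ h, lp.single_apply_ne _ _ _ h]
        exact EdgeL2.hasDeriv_zero
    · rintro v v' ⟨φ, hφ⟩
      have h1 : ⟪v', (lp.single 2 e w : GraphL2 E)⟫_ℂ = ⟪v' e, w⟫_ℂ := lp.inner_single_right _ _ _
      have h2 : ∀ c : ℂ, ⟪v, c • (lp.single 2 e u : GraphL2 E)⟫_ℂ = ⟪v e, c • u⟫_ℂ := fun c => by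
        rw [← lp.single_smul]
        exact lp.inner_single_right _ _ _
      refine h1.trans (Eq.trans ?_ (h2 _).symm)
      rw [hp _ _ _ _ (hφ e), he]
      ring

end UnitMetricGraph

/-! ### Reduction to the vertices of the Cayley graph -/

section Cayley

variable {Γ ι : Type*} [AddCommGroup Γ] (g : ι → Γ) (n : ℕ)

/-- The increment of the vertex along an edge of `cayleyGraphWithLoops g n`. -/
def cayleyStep : ι ⊕ Fin n → Γ := Sum.elim g fun _ => 0

/-- Translation of each edge of `cayleyGraphWithLoops g n` by its own increment. -/
def cayleyShift : Equiv.Perm (Γ × (ι ⊕ Fin n)) where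
  toFun e := (cayleyStep g n e.2 + e.1, e.2)
  invFun e := (e.1 - cayleyStep g n e.2, e.2)
  left_inv e := by simp
  right_inv e := by simp

theorem cayleyGraphWithLoops_src (e : Γ × (ι ⊕ Fin n)) :
    (cayleyGraphWithLoops g n).src e = e.1 := rfl

theorem cayleyGraphWithLoops_tgt (e : Γ × (ι ⊕ Fin n)) :
    (cayleyGraphWithLoops g n).tgt e = (cayleyShift g n e).1 := by
  obtain ⟨γ, i | i⟩ := e <;> simp [cayleyGraphWithLoops, cayleyShift, cayleyStep]

/-- Summation by parts: reindexing by `τ` groups the incoming derivatives `q` by their end vertex,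
where they balance the outgoing derivatives `p`. Square summability justifies the rearrangement. -/
theorem tsum_eq_tsum_of_kirchhoff {Γ J : Type*} [Fintype J] (τ : Equiv.Perm (Γ × J))
    {ψ : Γ → ℂ} {p q : Γ × J → ℂ} (hψ : Memℓp ψ 2) (hp : Memℓp p 2) (hq : Memℓp q 2)
    (h : ∀ γ, ∑ j, (q (τ.symm (γ, j)) - p (γ, j)) = 0) :
    ∑' e, (starRingEnd ℂ) (ψ (τ e).1) * q e = ∑' e : Γ × J, (starRingEnd ℂ) (ψ e.1) * p e := by
  have hψ' : Memℓp (fun e : Γ × J => ψ e.1) 2 := hψ.comp_fst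
  have h1 : Summable fun e : Γ × J => (starRingEnd ℂ) (ψ e.1) * q (τ.symm e) :=
    hψ'.summable_mul_two (hq.comp_equiv τ.symm)
  have h2 := hψ'.summable_mul_two hp
  have e1 : ∑' e, (starRingEnd ℂ) (ψ (τ e).1) * q e =
      ∑' e : Γ × J, (starRingEnd ℂ) (ψ e.1) * q (τ.symm e) := by
    rw [← Equiv.tsum_eq τ.symm]
    simp
  rw [e1, ← sub_eq_zero, ← h1.tsum_sub h2, (h1.sub h2).tsum_prod]
  simp only [tsum_fintype, ← mul_sub, ← Finset.mul_sum, h, mul_zero, tsum_zero]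

/-- The conclusion is the Kirchhoff condition for the edge solutions of `EdgeL2.exists_solution`:
derivatives at the ends of incoming edges minus derivatives at the starts of outgoing ones.
Multiplying by `sin k / k` turns it into the difference equation. -/
theorem exists_vertexValues [Fintype ι] {k : ℝ} (hk : 0 < k) (hs : Real.sin k ≠ 0)
    (hc : (n + Fintype.card ι) * Real.cos k < n - Fintype.card ι)
    {P Q : Γ × (ι ⊕ Fin n) → ℂ} (hP : Memℓp P 2) (hQ : Memℓp Q 2) :
    ∃ φ : Γ → ℂ, Memℓp φ 2 ∧ ∀ γ, ∑ j,
      ((k / Real.sin k * (φ γ * Real.cos k - φ ((cayleyShift g n).symm (γ, j)).1)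
        + Q ((cayleyShift g n).symm (γ, j))) -
      (k / Real.sin k * (φ (cayleyShift g n (γ, j)).1 - φ γ * Real.cos k) + P (γ, j))) = 0 := by
  have hh : Memℓp (fun γ => (Real.sin k / k : ℂ) *
      ∑ j, (Q ((cayleyShift g n).symm (γ, j)) - P (γ, j))) 2 := by
    refine Memℓp.const_mul (Memℓp.finsetSum Finset.univ fun j _ => ?_) _
    exact ((hQ.comp_equiv (cayleyShift g n).symm).comp_prodMk j).sub (hP.comp_prodMk j)
  obtain ⟨φ, hφ, h⟩ := exists_solution_differenceEquation g
    (D := 2 * n - 2 * (n + Fintype.card ι) * Real.cos k) (by linarith) hh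
  refine ⟨φ, hφ, fun γ => ?_⟩
  have hs' : ((Real.sin k : ℝ) : ℂ) ≠ 0 := by exact_mod_cast hs
  have hk' : (k : ℂ) ≠ 0 := by exact_mod_cast hk.ne'
  have key := h γ
  rw [div_mul_eq_mul_div, eq_div_iff hk'] at key
  have e1 : ∑ j, ((k / Real.sin k * (φ γ * Real.cos k - φ ((cayleyShift g n).symm (γ, j)).1)
        + Q ((cayleyShift g n).symm (γ, j))) -
      (k / Real.sin k * (φ (cayleyShift g n (γ, j)).1 - φ γ * Real.cos k) + P (γ, j))) =
      k / Real.sin k * (∑ j, (2 * (φ γ * Real.cos k) -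
        (φ ((cayleyShift g n).symm (γ, j)).1 + φ (cayleyShift g n (γ, j)).1))) +
      ∑ j, (Q ((cayleyShift g n).symm (γ, j)) - P (γ, j)) := by
    rw [Finset.mul_sum, ← Finset.sum_add_distrib]
    exact Finset.sum_congr rfl fun j _ => by ring
  have e2 : ∑ j, (2 * (φ γ * Real.cos k) -
        (φ ((cayleyShift g n).symm (γ, j)).1 + φ (cayleyShift g n (γ, j)).1)) =
      -(((2 * n - 2 * (n + Fintype.card ι) * Real.cos k : ℝ) : ℂ) * φ γ +
        ∑ i, (φ (γ - g i) + φ (g i + γ))) := by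
    -- A loop contributes `(2 cos k - 2) φ(γ)`, a generator `2 cos k φ(γ)` minus the two
    -- neighbouring values; this is the origin of `D`.
    rw [Fintype.sum_sum_type]
    simp [cayleyShift, cayleyStep, Finset.sum_sub_distrib, Finset.sum_const]
    ring
  rw [e1, e2, div_mul_eq_mul_div, div_add' _ _ _ hs', div_eq_zero_iff]
  left
  linear_combination -key

theorem cayley_notMem_spectrum [Fintype ι] (hn : 1 ≤ n) {k : ℝ} (hk : 0 < k)
    (hs : Real.sin k ≠ 0) (hc : (n + Fintype.card ι) * Real.cos k < n - Fintype.card ι) :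
    ((k ^ 2 : ℝ) : ℂ) ∉ unboundedSpectrum (cayleyGraphWithLoops g n).laplacian := by
  set X := cayleyGraphWithLoops g n with hX
  refine notMem_unboundedSpectrum_of_surjective X.laplacian_symmetric _ fun f => ?_
  rw [UnitMetricGraph.laplacian_graph]
  obtain ⟨C, hC0, hsol⟩ := EdgeL2.exists_solution hk hs
  choose P Q hP hQ hab using hsol
  have hf : Memℓp (fun e => C * ‖f e‖) 2 := (lp.memℓp f).norm.const_mul C
  have hPm : Memℓp (fun e => P (f e)) 2 := hf.mono fun e => hP _
  have hQm : Memℓp (fun e => Q (f e)) 2 := hf.mono fun e => hQ _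
  obtain ⟨φ, hφ, hkir⟩ := exists_vertexValues g n hk hs hc hPm hQm
  have hφs : Memℓp (fun e => φ (X.src e)) 2 := hφ.comp_fst
  have hφt : Memℓp (fun e => φ (X.tgt e)) 2 := by
    simp only [hX, cayleyGraphWithLoops_tgt]
    exact Memℓp.comp_equiv (f := fun e : Γ × (ι ⊕ Fin n) => φ e.1) hφ.comp_fst (cayleyShift g n)
  choose u w hu hw huw hgreen using fun e => hab (f e) (φ (X.src e)) (φ (X.tgt e))
  have hbound : Memℓp (fun e => C * (‖f e‖ + ‖φ (X.src e)‖ + ‖φ (X.tgt e)‖)) 2 :=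
    (((lp.memℓp f).norm.add hφs.norm).add hφt.norm).const_mul C
  refine ⟨⟨u, hbound.mono hu⟩, ⟨w, hbound.mono hw⟩, ⟨φ, huw⟩, ?_⟩
  rintro v v' ⟨ψ, hψ⟩
  -- A loop at each vertex serves as the chosen edge starting there.
  have hψm : Memℓp ψ 2 := X.memℓp_of_hasDeriv hψ (s := fun γ => (γ, Sum.inr ⟨0, hn⟩)) fun _ => rfl
  set q : Γ × (ι ⊕ Fin n) → ℂ := fun e =>
    k / Real.sin k * (φ (X.tgt e) * Real.cos k - φ (X.src e)) + Q (f e) with hq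
  set p : Γ × (ι ⊕ Fin n) → ℂ := fun e =>
    k / Real.sin k * (φ (X.tgt e) - φ (X.src e) * Real.cos k) + P (f e) with hp
  have hqm : Memℓp q 2 := by
    have h := (((hφt.const_mul (Real.cos k : ℂ)).sub hφs).const_mul (k / Real.sin k : ℂ)).add hQm
    convert! h using 1
    funext e
    simp [hq, mul_comm]
  have hpm : Memℓp p 2 := by
    have h := ((hφt.sub (hφs.const_mul (Real.cos k : ℂ))).const_mul (k / Real.sin k : ℂ)).add hPm
    convert! h using 1
    funext e
    simp [hp, mul_comm]
  have hψs : Memℓp (fun e => ψ (X.src e)) 2 := hψm.comp_fst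
  have hψt : Memℓp (fun e => ψ (X.tgt e)) 2 := by
    simp only [hX, cayleyGraphWithLoops_tgt]
    exact Memℓp.comp_equiv (f := fun e : Γ × (ι ⊕ Fin n) => ψ e.1) hψm.comp_fst (cayleyShift g n)
  have hkirchhoff := tsum_eq_tsum_of_kirchhoff (cayleyShift g n) hψm hpm hqm fun γ => by
    rw [← hkir γ]
    refine Finset.sum_congr rfl fun j _ => ?_
    simp [hq, hp, hX, cayleyGraphWithLoops_tgt, cayleyGraphWithLoops_src]
  -- Summing the edgewise Green formulas leaves exactly these boundary terms, and the Kirchhoff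
  -- condition makes their total vanish.
  have hsum := ((hψt.summable_mul_two hqm).hasSum.sub (hψs.summable_mul_two hpm).hasSum)
  have hzero : ∑' e, (starRingEnd ℂ) (ψ (X.tgt e)) * q e -
      ∑' e, (starRingEnd ℂ) (ψ (X.src e)) * p e = 0 := by
    rw [sub_eq_zero]
    simpa only [hX, cayleyGraphWithLoops_tgt, cayleyGraphWithLoops_src] using hkirchhoff
  rw [hzero] at hsum
  set U : GraphL2 (Γ × (ι ⊕ Fin n)) := ⟨u, hbound.mono hu⟩
  set W : GraphL2 (Γ × (ι ⊕ Fin n)) := ⟨w, hbound.mono hw⟩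
  have h1 := (lp.hasSum_inner (𝕜 := ℂ) v (f + ((k ^ 2 : ℝ) : ℂ) • U)).add hsum
  rw [add_zero] at h1
  refine (lp.hasSum_inner (𝕜 := ℂ) v' W).unique ?_
  refine h1.congr_fun fun e => ?_
  have h2 := hgreen e _ _ _ _ (hψ e)
  change ⟪v' e, w e⟫_ℂ = ⟪v e, f e + ((k ^ 2 : ℝ) : ℂ) • u e⟫_ℂ + _
  rw [h2]
  ring

end Cayley

/-! ### Construction of infinitely many gaps -/

theorem mainTheorem6 {Γ : Type*} [AddCommGroup Γ] {ι : Type*} [Finite ι] (g : ι → Γ)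
    (hg : AddSubgroup.closure (Set.range g) = ⊤) (n : ℕ) (hn : 1 ≤ n) :
    (spectralGaps (cayleyGraphWithLoops g n).laplacian).Infinite := by
  have := Fintype.ofFinite ι
  set T := (cayleyGraphWithLoops g n).laplacian
  set r : ℝ := (Fintype.card ι : ℝ)
  have hr : 0 ≤ r := Nat.cast_nonneg _
  have hn' : (1 : ℝ) ≤ n := by exact_mod_cast hn
  obtain ⟨θ, hθ0, hθ, hθc⟩ : ∃ θ : ℝ, 0 < θ ∧ θ < Real.pi ∧ (n + r) * Real.cos θ < n - r := by
    have hq : -1 < (n - r) / (n + r) := by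
      rw [lt_div_iff₀ (by positivity)]
      linarith
    have hq' : (n - r) / (n + r) ≤ 1 := by
      rw [div_le_one (by positivity)]
      linarith
    have h1 : Real.arccos ((n - r) / (n + r)) < Real.pi := by
      refine lt_of_le_of_ne (Real.arccos_le_pi _) fun h => ?_
      rw [Real.arccos_eq_pi] at h
      linarith
    have h0 := Real.arccos_nonneg ((n - r) / (n + r))
    -- The midpoint between the critical angle and `π` stays positive even when the critical angle
    -- is `0`, and its cosine is strictly below the threshold.
    refine ⟨(Real.arccos ((n - r) / (n + r)) + Real.pi) / 2, by linarith [Real.pi_pos],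
      by linarith, ?_⟩
    rw [← lt_div_iff₀' (by positivity)]
    calc _ < Real.cos (Real.arccos ((n - r) / (n + r))) :=
          Real.cos_lt_cos_of_nonneg_of_le_pi h0 (by linarith) (by linarith)
      _ = _ := Real.cos_arccos hq.le hq'
  let S : Set ℝ := {x | (x : ℂ) ∈ unboundedSpectrum T}
  have hS : IsClosed S := (isClosed_unboundedSpectrum T).preimage Complex.continuous_ofReal
  have hmem : ∀ m : ℕ, m ≠ 0 → (2 * Real.pi * m) ^ 2 ∈ S := fun m hm =>
    UnitMetricGraph.mem_spectrum_of_loop _ (e := ((0 : Γ), Sum.inr ⟨0, hn⟩)) rfl hm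
  have hpi := Real.pi_pos
  -- The index starts at `m + 1` because the sine eigenfunction is trivial for `m = 0`.
  have hgap : ∀ m : ℕ, ∃ p ∈ spectralGaps T, (2 * Real.pi * (m + 1 : ℕ)) ^ 2 ≤ p.1 ∧
      p.2 ≤ (2 * Real.pi * (m + 1 + 1 : ℕ)) ^ 2 := by
    intro m
    have hx : (θ + (m + 1 : ℕ) * (2 * Real.pi)) ^ 2 ∉ S := by
      refine cayley_notMem_spectrum g n hn (by positivity) ?_ ?_
      · rw [Real.sin_add_nat_mul_two_pi]
        exact (Real.sin_pos_of_pos_of_lt_pi hθ0 hθ).ne'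
      · rw [Real.cos_add_nat_mul_two_pi]
        exact hθc
    obtain ⟨a, b, h1, h2, h3, h4, h5, h6⟩ := exists_gap hS (hmem (m + 1) (by simp))
      (hmem (m + 1 + 1) (by simp)) (by gcongr; linarith)
      (by
        gcongr
        push_cast
        linarith) hx
    exact ⟨(a, b), ⟨h2, h4, h5, h6⟩, h1, h3⟩
  choose p hp h1 h2 using hgap
  -- Successive gaps lie in adjacent intervals between loop eigenvalues, so their left ends increase
  -- strictly and the gaps are distinct.
  have hmono : StrictMono fun m => (p m).1 := strictMono_nat_of_lt_succ fun m =>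
    ((hp m).1.trans_le (h2 m)).trans_le (h1 (m + 1))
  exact infinite_of_injective_forall_mem (fun a b h => hmono.injective (congrArg Prod.fst h)) hp
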